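/- Let $\theta>0$. For $N\ge 1$, the Ewens measure with parameter $\theta$ on the symmetric group $S_N$ is the probability measure $$\mu_N(\{\sigma\})=\frac{\theta^{\#(\sigma)}}{\theta(\theta+1)\cdots(\theta+N-1)},\qquad \sigma\in S_N,$$ where $\#(\sigma)$ is the number of cycles of $\sigma$, fixed points included. For each $N$ let $\sigma_N$ be a random permutation with law $\mu_N$ (the $\sigma_N$ may be defined on different probability spaces), and let $$A^{(N)}=\#\{\,1\le i\le N-1 : \sigma_N(i+1)=\sigma_N(i)+1 \text{ or } \sigma_N(i+1)=\sigma_N(i)-1\,\}$$ be its number of adjacencies. Then, as $N\to\infty$, $A^{(N)}$ converges in distribution to a Poisson random variable with parameter $2$. -/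

import Mathlib

open MeasureTheory ProbabilityTheory Filter

namespace Ewens

/-- The symmetric group on `Fin N` is a finite set; it carries the discrete σ-algebra. -/
instance instMeasurableSpacePerm (N : ℕ) : MeasurableSpace (Equiv.Perm (Fin N)) := ⊤

instance instDiscreteMeasurableSpacePerm (N : ℕ) :
    DiscreteMeasurableSpace (Equiv.Perm (Fin N)) := ⟨fun _ => trivial⟩

/-- The number of cycles of a permutation, fixed points included: the number of
classes of the relation "being in the same cycle". -/
noncomputable def numCycles {N : ℕ} (σ : Equiv.Perm (Fin N)) : ℕ :=
  Nat.card (Quotient (Equiv.Perm.SameCycle.setoid σ))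

/-- The Ewens weight `θ ^ #(σ) / (θ (θ + 1) ⋯ (θ + N - 1))`. -/
noncomputable def ewensWeight (θ : ℝ) {N : ℕ} (σ : Equiv.Perm (Fin N)) : ℝ :=
  θ ^ numCycles σ / ∏ k ∈ Finset.range N, (θ + k)

/-- The Ewens measure with parameter `θ` on the symmetric group on `Fin N`. -/
noncomputable def ewensMeasure (θ : ℝ) (N : ℕ) : Measure (Equiv.Perm (Fin N)) :=
  ∑ σ : Equiv.Perm (Fin N), ENNReal.ofReal (ewensWeight θ σ) • Measure.dirac σ

/-- The number of adjacencies of `σ`: the number of positions `i` such that `i + 1` is also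
a position and `σ (i + 1) = σ i + 1` or `σ (i + 1) = σ i - 1` (as integers). -/
def numAdjacencies {N : ℕ} (σ : Equiv.Perm (Fin N)) : ℕ :=
  (Finset.univ.filter fun i : Fin N => ∃ h : (i : ℕ) + 1 < N,
    ((σ ⟨i + 1, h⟩ : ℕ) : ℤ) = ((σ i : ℕ) : ℤ) + 1 ∨
    ((σ ⟨i + 1, h⟩ : ℕ) : ℤ) = ((σ i : ℕ) : ℤ) - 1).card

theorem ewensMeasure_singleton (θ : ℝ) (N : ℕ) (σ : Equiv.Perm (Fin N)) :
    ewensMeasure θ N {σ} = ENNReal.ofReal (ewensWeight θ σ) := by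
  classical
  simp only [ewensMeasure, Measure.coe_finsetSum, Finset.sum_apply, Measure.smul_apply,
    Measure.dirac_apply, smul_eq_mul]
  rw [Finset.sum_eq_single σ]
  · simp
  · intro τ _ h
    simp [h]
  · simp

theorem eq_of_sameCycle {α β : Type*} {f : Equiv.Perm α} (r : α → β)
    (h : ∀ a, r (f a) = r a) {a b : α} (hab : f.SameCycle a b) : r a = r b := by
  obtain ⟨i, rfl⟩ := hab
  induction i with
  | zero => simp
  | succ n ih =>
    rw [ih, add_comm, zpow_add, zpow_one, Equiv.Perm.mul_apply, h]
  | pred n ih =>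
    rw [ih, ← h ((f ^ (-(n : ℤ) - 1)) a), ← Equiv.Perm.mul_apply, ← zpow_one_add]
    congr 3
    ring

theorem sameCycle_decomposeFin {N : ℕ} (p : Fin (N + 1)) (e : Equiv.Perm (Fin N)) {x y : Fin N}
    (h : e.SameCycle x y) :
    (Equiv.Perm.decomposeFin.symm (p, e)).SameCycle x.succ y.succ := by
  set f := Equiv.Perm.decomposeFin.symm (p, e) with hf
  let inst : Setoid (Fin (N + 1)) := Equiv.Perm.SameCycle.setoid f
  have key := eq_of_sameCycle (f := e) (fun x : Fin N => (⟦x.succ⟧ : Quotient inst)) (fun a => by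
    refine Quotient.sound ?_
    change f.SameCycle _ _
    by_cases hp : (e a).succ = p
    · have h1 : f a.succ = 0 := by simp [hf, hp]
      have h2 : f 0 = (e a).succ := by simp [hf, hp]
      rw [← h2, ← h1]
      simp [Equiv.Perm.SameCycle.refl]
    · have h1 : f a.succ = (e a).succ := by
        rw [hf, Equiv.Perm.decomposeFin_symm_apply_succ,
          Equiv.swap_apply_of_ne_of_ne (Fin.succ_ne_zero _) hp]
      rw [← h1]
      simp [Equiv.Perm.SameCycle.refl]) h
  exact Quotient.exact key

theorem numCycles_decomposeFin_zero {N : ℕ} (e : Equiv.Perm (Fin N)) :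
    numCycles (Equiv.Perm.decomposeFin.symm (0, e)) = numCycles e + 1 := by
  set f := Equiv.Perm.decomposeFin.symm ((0 : Fin (N + 1)), e) with hf
  let r : Fin (N + 1) → Option (Quotient (Equiv.Perm.SameCycle.setoid e)) :=
    Fin.cases none (fun x => some (Quotient.mk _ x))
  have hr : ∀ a, r (f a) = r a := by
    intro a
    refine Fin.cases ?_ (fun x => ?_) a
    · simp [hf]
    · simp only [hf, Equiv.Perm.decomposeFin_symm_apply_succ, Equiv.swap_self, Equiv.refl_apply]
      simp only [r, Fin.cases_succ, Option.some.injEq]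
      exact Quotient.sound (Equiv.Perm.sameCycle_apply_left.2 (Equiv.Perm.SameCycle.refl _ _))
  let R : Quotient (Equiv.Perm.SameCycle.setoid f) →
      Option (Quotient (Equiv.Perm.SameCycle.setoid e)) :=
    Quotient.lift r (fun a b h => eq_of_sameCycle r hr h)
  have hR : Function.Bijective R := by
    constructor
    · rintro ⟨a⟩ ⟨b⟩
      change r a = r b → _
      refine Fin.cases ?_ (fun x => ?_) a <;> refine Fin.cases ?_ (fun y => ?_) b
      · intro _; rfl
      · intro h; simp [r] at h
      · intro h; simp [r] at h
      · intro h
        simp only [r, Fin.cases_succ, Option.some.injEq] at h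
        exact Quotient.sound (sameCycle_decomposeFin 0 e (Quotient.exact h))
    · rintro (_ | ⟨⟨x⟩⟩)
      · exact ⟨Quotient.mk _ 0, rfl⟩
      · exact ⟨Quotient.mk _ x.succ, rfl⟩
  rw [numCycles, Nat.card_eq_of_bijective R hR, Finite.card_option, numCycles]

theorem numCycles_decomposeFin_succ {N : ℕ} (q : Fin N) (e : Equiv.Perm (Fin N)) :
    numCycles (Equiv.Perm.decomposeFin.symm (q.succ, e)) = numCycles e := by
  set f := Equiv.Perm.decomposeFin.symm (q.succ, e) with hf
  let r : Fin (N + 1) → Quotient (Equiv.Perm.SameCycle.setoid e) :=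
    Fin.cases (Quotient.mk _ q) (fun x => Quotient.mk _ x)
  have hr : ∀ a, r (f a) = r a := by
    intro a
    refine Fin.cases ?_ (fun x => ?_) a
    · simp [hf, r]
    · have hx : (Quotient.mk (Equiv.Perm.SameCycle.setoid e) (e x)) = Quotient.mk _ x :=
        Quotient.sound (Equiv.Perm.sameCycle_apply_left.2 (Equiv.Perm.SameCycle.refl _ _))
      rw [hf, Equiv.Perm.decomposeFin_symm_apply_succ]
      by_cases hp : e x = q
      · rw [hp, Equiv.swap_apply_right]
        simp only [r, Fin.cases_zero, Fin.cases_succ]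
        rw [← hx, hp]
      · rw [Equiv.swap_apply_of_ne_of_ne (Fin.succ_ne_zero _) (by simpa using hp)]
        exact hx
  let R : Quotient (Equiv.Perm.SameCycle.setoid f) → Quotient (Equiv.Perm.SameCycle.setoid e) :=
    Quotient.lift r (fun a b h => eq_of_sameCycle r hr h)
  have h0 : ∀ a : Fin (N + 1), ∃ x : Fin N, f.SameCycle a x.succ := by
    intro a
    refine Fin.cases ⟨q, 1, by simp [hf]⟩ (fun x => ⟨x, Equiv.Perm.SameCycle.refl _ _⟩) a
  have hR : Function.Bijective R := by
    constructor
    · rintro ⟨a⟩ ⟨b⟩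
      obtain ⟨x, hx⟩ := h0 a
      obtain ⟨y, hy⟩ := h0 b
      change r a = r b → _
      rw [eq_of_sameCycle r hr hx, eq_of_sameCycle r hr hy]
      intro h
      exact Quotient.sound (hx.trans ((sameCycle_decomposeFin q.succ e
        (Quotient.exact h)).trans hy.symm))
    · rintro ⟨x⟩
      exact ⟨Quotient.mk _ x.succ, rfl⟩
  rw [numCycles, Nat.card_eq_of_bijective R hR, numCycles]

theorem sum_pow_numCycles (θ : ℝ) (N : ℕ) :
    ∑ σ : Equiv.Perm (Fin N), θ ^ numCycles σ = ∏ k ∈ Finset.range N, (θ + k) := by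
  induction N with
  | zero => simp [numCycles]
  | succ N ih =>
    rw [Finset.prod_range_succ, ← ih, ← Equiv.sum_comp Equiv.Perm.decomposeFin.symm,
      Fintype.sum_prod_type, Fin.sum_univ_succ]
    simp only [numCycles_decomposeFin_zero, numCycles_decomposeFin_succ, pow_succ,
      Finset.sum_const, Finset.card_univ, Fintype.card_fin, nsmul_eq_mul, ← Finset.sum_mul]
    ring

theorem isProbabilityMeasure_ewensMeasure {θ : ℝ} (hθ : 0 < θ) (N : ℕ) :
    IsProbabilityMeasure (ewensMeasure θ N) := by
  constructor
  have hpos : 0 < ∏ k ∈ Finset.range N, (θ + (k : ℝ)) :=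
    Finset.prod_pos fun k _ => by positivity
  simp only [ewensMeasure, Measure.coe_finsetSum, Finset.sum_apply, Measure.smul_apply,
    measure_univ, smul_eq_mul, mul_one]
  have hw : ∀ σ ∈ (Finset.univ : Finset (Equiv.Perm (Fin N))), 0 ≤ ewensWeight θ σ :=
    fun σ _ => div_nonneg (pow_nonneg hθ.le _) hpos.le
  rw [← ENNReal.ofReal_sum_of_nonneg hw]
  simp only [ewensWeight, ← Finset.sum_div, sum_pow_numCycles]
  rw [div_self hpos.ne', ENNReal.ofReal_one]

end Ewens

/-!
Deleting the smallest element of a permutation from its cycle representation turns the Ewens measure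
on `N + 1` points into that on `N` points. Conversely, a new smallest element opens its own cycle
with probability `θ / (θ + N)` and is inserted after each given element with probability
`1 / (θ + N)`. Inserting it after `j` moves the value of position `j` to the new first position, so
it destroys the adjacencies at `j` and creates new ones. Summed over `j`, the losses amount to twice
the number of adjacencies and the gains to `4` up to end effects, while two changes for the same `j`
are rare because the values of an Ewens permutation are nearly uniform. Up to an error of order
`1 / N ^ 2`, the number of adjacencies thus performs, with step size `s = 1 / (θ + N)`, a step of
the birth–death chain with birth rate `4` and death rate `2 * a` at `a`, whose stationary law is
Poisson with parameter `2`.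

Such a step sends `a ↦ (1 - u) ^ a` to `exp (-4 * s * u)` times `a ↦ (1 - (1 - 2 * s) * u) ^ a` up
to `O(s ^ 2)`, and the Poisson generating function `exp (-2 * u)` satisfies the same relation
exactly. So the distance between the two generating functions at `1 - u` is at most their previous
distance at `1 - (1 - 2 * s) * u`, up to a summable error. The factors `1 - 2 * s`
multiply to `0`, and at `u = 0` all generating functions agree.
-/

namespace Ewens

/-! ### Inserting a new smallest element -/

theorem ewensWeight_nonneg {θ : ℝ} (hθ : 0 < θ) {N : ℕ} (σ : Equiv.Perm (Fin N)) :
    0 ≤ ewensWeight θ σ := by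
  unfold ewensWeight; positivity

instance isFiniteMeasure_ewensMeasure (θ : ℝ) (N : ℕ) : IsFiniteMeasure (ewensMeasure θ N) := by
  simp [isFiniteMeasure_iff, ewensMeasure]

theorem integral_ewensMeasure {θ : ℝ} (hθ : 0 < θ) (N : ℕ) (f : Equiv.Perm (Fin N) → ℝ) :
    ∫ σ, f σ ∂ewensMeasure θ N = ∑ σ, ewensWeight θ σ * f σ := by
  rw [integral_fintype .of_finite]
  refine Finset.sum_congr rfl fun σ _ => ?_
  rw [measureReal_def, ewensMeasure_singleton, ENNReal.toReal_ofReal (ewensWeight_nonneg hθ σ),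
    smul_eq_mul]

/-- The permutation of `{0, …, N}` that fixes `0` and acts as `e` on the other elements (shifted
by one): the Chinese restaurant process opening a new cycle for a new smallest element. -/
def insertFixed {N : ℕ} (e : Equiv.Perm (Fin N)) : Equiv.Perm (Fin (N + 1)) :=
  Equiv.Perm.decomposeFin.symm (0, e)

/-- The permutation of `{0, …, N}` obtained from `e` (shifted by one) by inserting `0` between `j`
and `e j` in the cycle of `j`: the Chinese restaurant process placing a new smallest element in an
existing cycle. -/
def insertAfter {N : ℕ} (e : Equiv.Perm (Fin N)) (j : Fin N) : Equiv.Perm (Fin (N + 1)) :=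
  Equiv.Perm.decomposeFin.symm ((e j).succ, e)

section Insert

variable {N : ℕ} (e : Equiv.Perm (Fin N)) (j x : Fin N)

@[simp] theorem insertFixed_zero : insertFixed e 0 = 0 := by simp [insertFixed]

@[simp] theorem insertFixed_succ : insertFixed e x.succ = (e x).succ := by simp [insertFixed]

@[simp] theorem insertAfter_zero : insertAfter e j 0 = (e j).succ := by simp [insertAfter]

@[simp] theorem insertAfter_succ_self : insertAfter e j j.succ = 0 := by simp [insertAfter]

theorem insertAfter_succ_of_ne {x j : Fin N} (h : x ≠ j) :
    insertAfter e j x.succ = (e x).succ := by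
  simp [insertAfter, Equiv.swap_apply_of_ne_of_ne, h]

theorem ewensWeight_insertFixed (θ : ℝ) :
    ewensWeight θ (insertFixed e) = (θ + N)⁻¹ * (θ * ewensWeight θ e) := by
  simp only [ewensWeight, insertFixed, numCycles_decomposeFin_zero, Finset.prod_range_succ,
    pow_succ, div_eq_mul_inv, mul_inv]
  ring

theorem ewensWeight_insertAfter (θ : ℝ) :
    ewensWeight θ (insertAfter e j) = (θ + N)⁻¹ * ewensWeight θ e := by
  simp only [ewensWeight, insertAfter, numCycles_decomposeFin_succ, Finset.prod_range_succ,
    div_eq_mul_inv, mul_inv]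
  ring

end Insert

theorem sum_perm_fin_succ {N : ℕ} (f : Equiv.Perm (Fin (N + 1)) → ℝ) :
    ∑ σ, f σ = ∑ e : Equiv.Perm (Fin N), (f (insertFixed e) + ∑ j, f (insertAfter e j)) := by
  rw [← Equiv.sum_comp Equiv.Perm.decomposeFin.symm, Fintype.sum_prod_type_right]
  refine Finset.sum_congr rfl fun e _ => ?_
  rw [Fin.sum_univ_succ, ← Equiv.sum_comp e]
  rfl

theorem integral_ewensMeasure_succ {θ : ℝ} (hθ : 0 < θ) (N : ℕ)
    (f : Equiv.Perm (Fin (N + 1)) → ℝ) :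
    ∫ σ, f σ ∂ewensMeasure θ (N + 1) =
      (θ + N)⁻¹ * ∫ e, (θ * f (insertFixed e) + ∑ j, f (insertAfter e j)) ∂ewensMeasure θ N := by
  simp only [integral_ewensMeasure hθ, sum_perm_fin_succ, ewensWeight_insertFixed,
    ewensWeight_insertAfter, Finset.mul_sum, mul_add]
  refine Finset.sum_congr rfl fun e _ => ?_
  congr 1
  · ring
  · exact Finset.sum_congr rfl fun _ _ => by ring

/-! ### Near-uniformity of the values of an Ewens permutation -/

theorem numCycles_le_numCycles_mul_swap {N : ℕ} (e : Equiv.Perm (Fin N)) (a b : Fin N) :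
    numCycles e ≤ numCycles (e * Equiv.swap a b) + 1 := by
  classical
  let cycleOf : Fin N → Quotient (Equiv.Perm.SameCycle.setoid e) := Quotient.mk _
  have cycleOf_apply (x) : cycleOf (e x) = cycleOf x :=
    Quotient.sound (Equiv.Perm.sameCycle_apply_left.2 (Equiv.Perm.SameCycle.refl _ _))
  -- Merging the cycle of `b` into that of `a` gives an invariant of `e * swap a b`.
  let merged (x : Fin N) := if cycleOf x = cycleOf b then cycleOf a else cycleOf x
  have merged_apply (x) : merged ((e * Equiv.swap a b) x) = merged x := by
    simp only [merged, Equiv.Perm.mul_apply, cycleOf_apply, Equiv.swap_apply_def]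
    split_ifs <;> simp_all
  let F : Option (Quotient (Equiv.Perm.SameCycle.setoid (e * Equiv.swap a b))) →
      Quotient (Equiv.Perm.SameCycle.setoid e)
    | none => cycleOf b
    | some c => Quotient.lift merged (fun _ _ => eq_of_sameCycle merged merged_apply) c
  have hF : Function.Surjective F := by
    rintro ⟨x⟩
    by_cases hx : cycleOf x = cycleOf b
    · exact ⟨none, hx.symm⟩
    · exact ⟨some ⟦x⟧, if_neg hx⟩
  simpa [numCycles, Finite.card_option] using Nat.card_le_card_of_surjective F hF

theorem one_le_max_inv {θ : ℝ} (hθ : 0 < θ) : 1 ≤ max θ θ⁻¹ :=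
  le_max_iff.2 ((le_total 1 θ).imp_right (one_le_inv₀ hθ).2)

theorem pow_le_max_inv_mul_pow {θ : ℝ} (hθ : 0 < θ) {m n : ℕ} (hmn : m ≤ n + 1)
    (hnm : n ≤ m + 1) : θ ^ m ≤ max θ θ⁻¹ * θ ^ n := by
  have hn : 0 < θ ^ n := by positivity
  obtain rfl | rfl | rfl : m = n + 1 ∨ m = n ∨ n = m + 1 := by omega
  · rw [pow_succ']
    gcongr
    exact le_max_left _ _
  · exact le_mul_of_one_le_left hn.le (one_le_max_inv hθ)
  · calc θ ^ m = θ⁻¹ * θ ^ (m + 1) := by rw [pow_succ', inv_mul_cancel_left₀ hθ.ne']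
      _ ≤ _ := by gcongr; exact le_max_right _ _

theorem ewensWeight_le_mul_swap {θ : ℝ} (hθ : 0 < θ) {N : ℕ} (σ : Equiv.Perm (Fin N))
    (a b : Fin N) :
    ewensWeight θ σ ≤ max θ θ⁻¹ * ewensWeight θ (σ * Equiv.swap a b) := by
  have h := numCycles_le_numCycles_mul_swap (σ * Equiv.swap a b) a b
  rw [mul_assoc, Equiv.swap_mul_self, mul_one] at h
  rw [ewensWeight, ewensWeight, ← mul_div_assoc]
  gcongr
  exact pow_le_max_inv_mul_pow hθ (numCycles_le_numCycles_mul_swap σ a b) h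

theorem measureReal_ewensMeasure {θ : ℝ} (hθ : 0 < θ) {N : ℕ} (S : Set (Equiv.Perm (Fin N))) :
    (ewensMeasure θ N).real S = ∑ σ, ewensWeight θ σ * S.indicator 1 σ := by
  rw [← integral_indicator_one .of_discrete, integral_ewensMeasure hθ]

theorem measureReal_le_mul_measureReal_mul_swap {θ : ℝ} (hθ : 0 < θ) {N : ℕ}
    (S : Set (Equiv.Perm (Fin N))) (a b : Fin N) :
    (ewensMeasure θ N).real S ≤
      max θ θ⁻¹ * (ewensMeasure θ N).real {σ | σ * Equiv.swap a b ∈ S} := by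
  rw [measureReal_ewensMeasure hθ, measureReal_ewensMeasure hθ, Finset.mul_sum,
    ← Equiv.sum_comp (Equiv.mulRight (Equiv.swap a b))
      fun σ => max θ θ⁻¹ * (ewensWeight θ σ * {σ | σ * Equiv.swap a b ∈ S}.indicator 1 σ)]
  refine Finset.sum_le_sum fun σ _ => ?_
  have hσ : {σ | σ * Equiv.swap a b ∈ S}.indicator (1 : Equiv.Perm (Fin N) → ℝ)
      (σ * Equiv.swap a b) = S.indicator 1 σ :=
    Set.indicator_eq_indicator (by simp [mul_assoc]) rfl
  rw [Equiv.coe_mulRight, hσ, ← mul_assoc]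
  exact mul_le_mul_of_nonneg_right (ewensWeight_le_mul_swap hθ σ a b)
    (Set.indicator_nonneg (fun _ _ => zero_le_one) σ)

theorem sum_measureReal_le_mul {Ω ι : Type*} [MeasurableSpace Ω] {μ : Measure Ω}
    [IsFiniteMeasure μ] (s : Finset ι) {A : ι → Set Ω} {B : Set Ω} {m : ℕ}
    [∀ ω, DecidablePred fun i => ω ∈ A i] (hA : ∀ i, MeasurableSet (A i)) (hB : MeasurableSet B)
    (hAB : ∀ i, A i ⊆ B) (hm : ∀ ω, (s.filter fun i => ω ∈ A i).card ≤ m) :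
    ∑ i ∈ s, μ.real (A i) ≤ m * μ.real B := by
  have integrable_indicator {S : Set Ω} (hS : MeasurableSet S) :
      Integrable (S.indicator (1 : Ω → ℝ)) μ := (integrable_const (1 : ℝ)).indicator hS
  simp_rw [← integral_indicator_one (hA _), ← integral_indicator_one hB]
  rw [← integral_finsetSum _ fun i _ => integrable_indicator (hA i), ← integral_const_mul]
  refine integral_mono (integrable_finsetSum _ fun i _ => integrable_indicator (hA i))
    ((integrable_indicator hB).const_mul _) fun ω => ?_
  by_cases hω : ω ∈ B
  · simpa [Set.indicator_apply, hω] using hm ω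
  · simp [hω, fun i => mt (@hAB i ω) hω]

/-- Conditionally on the values of a permutation on `X`, its value at a further point is nearly
uniform: swapping that point with another one changes the weight by a bounded factor. -/
theorem measureReal_and_apply_mem_le {θ : ℝ} (hθ : 0 < θ) {N m : ℕ} {X : Finset (Fin N)}
    {x : Fin N} (hx : x ∉ X) {B : Set (Equiv.Perm (Fin N))}
    {T : Equiv.Perm (Fin N) → Finset (Fin N)}
    (hB : ∀ e e' : Equiv.Perm (Fin N), Set.EqOn e e' X → e ∈ B → e' ∈ B)
    (hT : ∀ e e' : Equiv.Perm (Fin N), Set.EqOn e e' X → T e = T e') (hm : ∀ e, (T e).card ≤ m) :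
    (N - X.card) * (ewensMeasure θ N).real {e | e ∈ B ∧ e x ∈ T e} ≤
      max θ θ⁻¹ * (m * (ewensMeasure θ N).real B) := by
  have swap_le (y) (hy : y ∈ Xᶜ) : (ewensMeasure θ N).real {e | e ∈ B ∧ e x ∈ T e} ≤
      max θ θ⁻¹ * (ewensMeasure θ N).real {e | e ∈ B ∧ e y ∈ T e} := by
    refine (measureReal_le_mul_measureReal_mul_swap hθ _ x y).trans ?_
    refine mul_le_mul_of_nonneg_left (measureReal_mono fun e he => ?_) (by positivity)
    have hagree : Set.EqOn (e * Equiv.swap x y) e X := fun i hi => by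
      rw [Equiv.Perm.mul_apply, Equiv.swap_apply_of_ne_of_ne]
      · exact ne_of_mem_of_not_mem hi hx
      · exact ne_of_mem_of_not_mem hi (Finset.mem_compl.1 hy)
    simpa [hT _ _ hagree] using And.imp_left (hB _ _ hagree) he
  calc (N - X.card) * (ewensMeasure θ N).real {e | e ∈ B ∧ e x ∈ T e}
      = ∑ _y ∈ Xᶜ, (ewensMeasure θ N).real {e | e ∈ B ∧ e x ∈ T e} := by
        rw [Finset.sum_const, nsmul_eq_mul, Finset.card_compl, Nat.cast_sub X.card_le_univ,
          Fintype.card_fin]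
    _ ≤ max θ θ⁻¹ * ∑ y ∈ Xᶜ, (ewensMeasure θ N).real {e | e ∈ B ∧ e y ∈ T e} := by
        rw [Finset.mul_sum]
        exact Finset.sum_le_sum swap_le
    _ ≤ max θ θ⁻¹ * (m * (ewensMeasure θ N).real B) := by
        classical
        gcongr
        refine sum_measureReal_le_mul _ (fun _ => .of_discrete) .of_discrete (fun _ _ => And.left)
          fun e => le_trans ?_ (hm e)
        exact Finset.card_le_card_of_injOn e (fun y hy => (Finset.mem_filter.1 hy).2.2)
          e.injective.injOn

theorem measureReal_and_apply_mem_le_div {θ : ℝ} (hθ : 0 < θ) {N : ℕ} (hN : 3 ≤ N)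
    {X : Finset (Fin N)} (hX : X.card ≤ 2) {x : Fin N} (hx : x ∉ X)
    {B : Set (Equiv.Perm (Fin N))} {T : Equiv.Perm (Fin N) → Finset (Fin N)}
    (hB : ∀ e e' : Equiv.Perm (Fin N), Set.EqOn e e' X → e ∈ B → e' ∈ B)
    (hT : ∀ e e' : Equiv.Perm (Fin N), Set.EqOn e e' X → T e = T e') (hm : ∀ e, (T e).card ≤ 3) :
    (ewensMeasure θ N).real {e | e ∈ B ∧ e x ∈ T e} ≤
      9 * max θ θ⁻¹ / N * (ewensMeasure θ N).real B := by
  have hN' : (3 : ℝ) ≤ N := mod_cast hN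
  have hX' : (X.card : ℝ) ≤ 2 := mod_cast hX
  have h := measureReal_and_apply_mem_le hθ hx hB hT hm
  rw [div_mul_eq_mul_div, le_div_iff₀ (by linarith)]
  calc (ewensMeasure θ N).real {e | e ∈ B ∧ e x ∈ T e} * N
      ≤ (ewensMeasure θ N).real {e | e ∈ B ∧ e x ∈ T e} * (3 * (N - X.card)) := by
        gcongr; linarith
    _ ≤ 9 * max θ θ⁻¹ * (ewensMeasure θ N).real B := by push_cast at h; linarith

/-! ### Adjacencies as edges of a graph -/

theorem degree_eq_sum_ite {V : Type*} [Fintype V] (G : SimpleGraph V) [DecidableRel G.Adj]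
    (a : V) : G.degree a = ∑ b, if G.Adj a b then 1 else 0 := by
  rw [← SimpleGraph.card_neighborFinset_eq_degree, SimpleGraph.neighborFinset_eq_filter,
    Finset.card_filter]

theorem card_edgeFinset_add_degree_eq {V : Type*} [Fintype V] (G H : SimpleGraph V)
    [DecidableRel G.Adj] [DecidableRel H.Adj] {v : V}
    (h : ∀ a b, a ≠ v → b ≠ v → (G.Adj a b ↔ H.Adj a b)) :
    G.edgeFinset.card + H.degree v = H.edgeFinset.card + G.degree v := by
  classical
  have hdel : G.deleteIncidenceSet v = H.deleteIncidenceSet v := by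
    ext a b
    simp only [SimpleGraph.deleteIncidenceSet_adj]
    have := h a b
    tauto
  have hcard : (G.deleteIncidenceSet v).edgeFinset.card =
      (H.deleteIncidenceSet v).edgeFinset.card :=
    congrArg Finset.card (SimpleGraph.edgeFinset_inj.2 hdel)
  rw [SimpleGraph.card_edgeFinset_deleteIncidenceSet,
    SimpleGraph.card_edgeFinset_deleteIncidenceSet] at hcard
  have := G.degree_le_card_edgeFinset v
  have := H.degree_le_card_edgeFinset v
  omega

theorem card_edgeFinset_comap_succ_add_degree_zero {n : ℕ} (G : SimpleGraph (Fin (n + 1)))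
    [DecidableRel G.Adj] :
    (G.comap Fin.succ).edgeFinset.card + G.degree 0 = G.edgeFinset.card := by
  let iso : G.comap Fin.succ ≃g G.induce {0}ᶜ :=
    { finSuccAboveEquiv 0 with map_rel_iff' := Iff.rfl }
  have := G.degree_le_card_edgeFinset 0
  rw [iso.card_edgeFinset_eq, SimpleGraph.card_edgeFinset_induce_compl_singleton,
    SimpleGraph.card_edgeFinset_deleteIncidenceSet]
  omega

open SimpleGraph (pathGraph pathGraph_adj)

instance decidableRelPathGraphAdj (N : ℕ) : DecidableRel (pathGraph N).Adj :=
  fun _ _ => decidable_of_iff' _ pathGraph_adj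

theorem degree_pathGraph_add {n : ℕ} (a : Fin (n + 1)) :
    (pathGraph (n + 1)).degree a + (if a = 0 then 1 else 0) +
      (if a = Fin.last n then 1 else 0) = 2 := by
  have hright : (Finset.univ.filter fun b : Fin (n + 1) => (a : ℕ) + 1 = b).card +
      (if a = Fin.last n then 1 else 0) = 1 := by
    cases a using Fin.lastCases with
    | last => simpa using fun b : Fin (n + 1) => b.isLt.ne'
    | cast i =>
      rw [if_neg i.castSucc_ne_last, add_zero, Finset.card_eq_one]
      exact ⟨i.succ, by ext b; simp [Fin.ext_iff, eq_comm]⟩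
  have hleft : (Finset.univ.filter fun b : Fin (n + 1) => (b : ℕ) + 1 = a).card +
      (if a = 0 then 1 else 0) = 1 := by
    cases a using Fin.cases with
    | zero => simp
    | succ i =>
      rw [if_neg i.succ_ne_zero, add_zero, Finset.card_eq_one]
      exact ⟨i.castSucc, by ext b; simp [Fin.ext_iff]⟩
  have hdisj : Disjoint (Finset.univ.filter fun b : Fin (n + 1) => (a : ℕ) + 1 = b)
      (Finset.univ.filter fun b : Fin (n + 1) => (b : ℕ) + 1 = a) :=
    Finset.disjoint_filter.2 fun b _ h h' => by omega
  rw [← SimpleGraph.card_neighborFinset_eq_degree, SimpleGraph.neighborFinset_eq_filter]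
  simp only [pathGraph_adj]
  rw [Finset.filter_or, Finset.card_union_of_disjoint hdisj]
  omega

/-- The graph on positions whose edges are the adjacencies of `e`: neighbouring positions with
neighbouring values. -/
def adjacencyGraph {N : ℕ} (e : Equiv.Perm (Fin N)) : SimpleGraph (Fin N) :=
  pathGraph N ⊓ (pathGraph N).comap e

theorem adjacencyGraph_adj {N : ℕ} {e : Equiv.Perm (Fin N)} {a b : Fin N} :
    (adjacencyGraph e).Adj a b ↔ (pathGraph N).Adj a b ∧ (pathGraph N).Adj (e a) (e b) := Iff.rfl

instance decidableRelAdjacencyGraphAdj {N : ℕ} (e : Equiv.Perm (Fin N)) :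
    DecidableRel (adjacencyGraph e).Adj :=
  fun _ _ => decidable_of_iff' _ adjacencyGraph_adj

theorem card_edgeFinset_adjacencyGraph {N : ℕ} (e : Equiv.Perm (Fin N)) :
    (adjacencyGraph e).edgeFinset.card = numAdjacencies e := by
  have hadj (i : Fin N) (h : (i : ℕ) + 1 < N) : (adjacencyGraph e).Adj i ⟨i + 1, h⟩ ↔
      ((e ⟨i + 1, h⟩ : ℕ) : ℤ) = (e i : ℕ) + 1 ∨ ((e ⟨i + 1, h⟩ : ℕ) : ℤ) = (e i : ℕ) - 1 := by
    simp only [adjacencyGraph_adj, pathGraph_adj, true_or, true_and]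
    omega
  have hinf (a b : Fin N) (h : (adjacencyGraph e).Adj a b) :
      ∃ h : ((a ⊓ b : Fin N) : ℕ) + 1 < N, s(a, b) = s(a ⊓ b, ⟨(a ⊓ b : Fin N) + 1, h⟩) := by
    rcases pathGraph_adj.1 h.1 with h | h
    · rw [inf_eq_left.2 (Fin.le_def.2 (by omega))]
      exact ⟨by omega, congrArg (s(_, ·)) (Fin.ext h.symm)⟩
    · rw [inf_eq_right.2 (Fin.le_def.2 (by omega)), Sym2.eq_swap]
      exact ⟨by omega, congrArg (s(_, ·)) (Fin.ext h.symm)⟩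
  refine Finset.card_nbij Sym2.inf ?_ ?_ ?_
  · intro s hs
    induction s with | _ a b
    obtain ⟨h, hab⟩ := hinf a b (by simpa using hs)
    rw [hab] at hs
    rw [SimpleGraph.coe_edgeFinset, SimpleGraph.mem_edgeSet, hadj] at hs
    exact Finset.mem_filter.2 ⟨Finset.mem_univ _, h, hs⟩
  · intro s hs t ht hst
    induction s with | _ a b
    induction t with | _ c d
    obtain ⟨_, hab⟩ := hinf a b (by simpa using hs)
    obtain ⟨_, hcd⟩ := hinf c d (by simpa using ht)
    rw [hab, hcd]
    simp only [Sym2.inf_mk] at hst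
    simp only [hst]
  · intro i hi
    obtain ⟨h, hi⟩ := (Finset.mem_filter.1 hi).2
    exact ⟨s(i, ⟨i + 1, h⟩), by simpa [hadj] using hi, by
      simp [Fin.le_def]⟩

/-! ### Adjacencies lost and gained by an insertion -/

@[simp] theorem pathGraph_succ_succ_adj {n : ℕ} {a b : Fin n} :
    (pathGraph (n + 1)).Adj a.succ b.succ ↔ (pathGraph n).Adj a b := by
  simp [pathGraph_adj]

@[simp] theorem pathGraph_zero_succ_adj {n : ℕ} {b : Fin (n + 1)} :
    (pathGraph (n + 2)).Adj 0 b.succ ↔ b = 0 := by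
  simp only [pathGraph_adj, Fin.ext_iff, Fin.val_succ, Fin.val_zero]
  omega

@[simp] theorem pathGraph_succ_zero_adj {n : ℕ} {b : Fin (n + 1)} :
    (pathGraph (n + 2)).Adj b.succ 0 ↔ b = 0 := by
  rw [SimpleGraph.adj_comm, pathGraph_zero_succ_adj]

section Recursion

variable {n : ℕ} (e : Equiv.Perm (Fin (n + 1))) (j : Fin (n + 1))

theorem numAdjacencies_insertFixed :
    numAdjacencies (insertFixed e) = numAdjacencies e + if e 0 = 0 then 1 else 0 := by
  have hcomap : (adjacencyGraph (insertFixed e)).comap Fin.succ = adjacencyGraph e := by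
    ext a b
    simp [adjacencyGraph_adj]
  have hdeg : (adjacencyGraph (insertFixed e)).degree 0 = if e 0 = 0 then 1 else 0 := by
    simp [degree_eq_sum_ite, Fin.sum_univ_succ, adjacencyGraph_adj, ite_and]
  rw [← card_edgeFinset_adjacencyGraph, ← card_edgeFinset_comap_succ_add_degree_zero, hdeg,
    ← card_edgeFinset_adjacencyGraph]
  exact congrArg (· + _) (congrArg Finset.card (SimpleGraph.edgeFinset_inj.2 hcomap))

/-- The number of adjacencies of `e` destroyed by passing to `insertAfter e j`: those that involve
position `j`. -/
def lost : ℕ := (adjacencyGraph e).degree j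

/-- The number of adjacencies created by passing to `insertAfter e j`. The new entries are the
value `0` at the (shifted) position `j` and the (shifted) value `e j` at position `0`. -/
def gained : ℕ :=
  (if (pathGraph (n + 1)).Adj j (e.symm 0) then 1 else 0) +
    (if (pathGraph (n + 1)).Adj (e j) (e 0) then 1 else 0) + if j = 0 ∧ e 0 = 0 then 1 else 0

/-- The amount by which the total gain falls short of `4`, caused by the end positions and the
extreme values having one neighbour only. -/
def deficit : ℕ :=
  (if e 0 = 0 then 1 else 0) + (if e 0 = Fin.last n then 1 else 0) +
    if e (Fin.last n) = 0 then 1 else 0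

theorem degree_zero_adjacencyGraph_insertAfter :
    (adjacencyGraph (insertAfter e j)).degree 0 =
      (if (pathGraph (n + 1)).Adj (e j) (e 0) then 1 else 0) +
        if j = 0 ∧ e 0 = 0 then 1 else 0 := by
  have hdeg : (adjacencyGraph (insertAfter e j)).degree 0 =
      if (pathGraph (n + 2)).Adj (e j).succ (insertAfter e j (Fin.succ 0)) then 1 else 0 := by
    simp [degree_eq_sum_ite, Fin.sum_univ_succ, adjacencyGraph_adj, ite_and]
  rw [hdeg]
  rcases eq_or_ne j 0 with rfl | hj
  · rw [insertAfter_succ_self]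
    simp
  · rw [insertAfter_succ_of_ne e hj.symm]
    simp [hj]

theorem numAdjacencies_insertAfter_add_lost :
    numAdjacencies (insertAfter e j) + lost e j = numAdjacencies e + gained e j := by
  set G := (adjacencyGraph (insertAfter e j)).comap Fin.succ with hG
  have hagree (a b) (ha : a ≠ j) (hb : b ≠ j) : G.Adj a b ↔ (adjacencyGraph e).Adj a b := by
    simp [hG, adjacencyGraph_adj, insertAfter_succ_of_ne, ha, hb]
  have hdeg : G.degree j = if (pathGraph (n + 1)).Adj j (e.symm 0) then 1 else 0 := by
    have hadj (b) : G.Adj j b ↔ b = e.symm 0 ∧ (pathGraph (n + 1)).Adj j b := by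
      rcases eq_or_ne b j with rfl | hb
      · simp
      · simp [hG, adjacencyGraph_adj, insertAfter_succ_of_ne e hb, Equiv.eq_symm_apply, and_comm]
    simp [degree_eq_sum_ite, hadj, ite_and]
  have h1 : G.edgeFinset.card + (adjacencyGraph (insertAfter e j)).degree 0 = _ :=
    card_edgeFinset_comap_succ_add_degree_zero (adjacencyGraph (insertAfter e j))
  have h2 := card_edgeFinset_add_degree_eq G (adjacencyGraph e) hagree
  rw [degree_zero_adjacencyGraph_insertAfter, card_edgeFinset_adjacencyGraph] at h1
  rw [card_edgeFinset_adjacencyGraph, hdeg] at h2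
  unfold lost gained
  omega

theorem sum_lost : ∑ j, lost e j = 2 * numAdjacencies e := by
  rw [← card_edgeFinset_adjacencyGraph, ← SimpleGraph.sum_degrees_eq_twice_card_edges]
  rfl

theorem sum_gained_add_deficit : ∑ j, gained e j + deficit e = 4 := by
  have hpos : ∑ j, (if (pathGraph (n + 1)).Adj j (e.symm 0) then 1 else 0) =
      (pathGraph (n + 1)).degree (e.symm 0) := by
    simp only [degree_eq_sum_ite, SimpleGraph.adj_comm]
  have hval : ∑ j, (if (pathGraph (n + 1)).Adj (e j) (e 0) then 1 else 0) =
      (pathGraph (n + 1)).degree (e 0) := by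
    rw [Equiv.sum_comp e fun a => if (pathGraph (n + 1)).Adj a (e 0) then 1 else 0]
    simp only [degree_eq_sum_ite, SimpleGraph.adj_comm]
  have hpos' := degree_pathGraph_add (e.symm 0)
  have hval' := degree_pathGraph_add (e 0)
  simp only [Equiv.symm_apply_eq, eq_comm (a := (0 : Fin (n + 1)))] at hpos'
  simp only [gained, deficit, Finset.sum_add_distrib, hpos, hval, ite_and, Finset.sum_ite_eq',
    Finset.mem_univ, if_true]
  omega

theorem lost_le_two : lost e j ≤ 2 := by
  have := degree_pathGraph_add j
  have : lost e j ≤ (pathGraph (n + 1)).degree j := SimpleGraph.degree_le_of_le inf_le_left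
  omega

theorem gained_le_three : gained e j ≤ 3 := by
  unfold gained
  split_ifs <;> simp

end Recursion

/-! ### Rarity of multiple changes -/

section Clusters

variable {n : ℕ}

/-- The point `0` together with the neighbours of `a`. An adjacency lost or gained by inserting a
new smallest element after `j` comes from a position in `cluster j` with value in
`cluster (e j)`. -/
def cluster (a : Fin (n + 1)) : Finset (Fin (n + 1)) :=
  insert 0 ((pathGraph (n + 1)).neighborFinset a)

/-- The positions in `cluster j` whose value lies in `cluster (e j)`. -/
def hits (e : Equiv.Perm (Fin (n + 1))) (j : Fin (n + 1)) : Finset (Fin (n + 1)) :=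
  (cluster j).filter fun x => e x ∈ cluster (e j)

theorem mem_cluster {a x : Fin (n + 1)} :
    x ∈ cluster a ↔ x = 0 ∨ (pathGraph (n + 1)).Adj a x := by
  simp [cluster]

theorem self_mem_cluster_iff {a : Fin (n + 1)} : a ∈ cluster a ↔ a = 0 := by
  simp [mem_cluster]

theorem degree_pathGraph_le_two (a : Fin (n + 1)) : (pathGraph (n + 1)).degree a ≤ 2 := by
  have := degree_pathGraph_add a
  omega

theorem card_cluster_le (a : Fin (n + 1)) : (cluster a).card ≤ 3 :=
  (Finset.card_insert_le _ _).trans <| Nat.succ_le_succ <| by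
    simpa using degree_pathGraph_le_two a

section Deterministic

variable {e : Equiv.Perm (Fin (n + 1))} {j : Fin (n + 1)}

theorem hits_nonempty_of_lost_add_gained_ne_zero (h : lost e j + gained e j ≠ 0) :
    (hits e j).Nonempty := by
  by_contra hempty
  simp only [Finset.not_nonempty_iff_eq_empty, hits, Finset.filter_eq_empty_iff,
    mem_cluster, not_or] at hempty
  have hlost : lost e j = 0 := by
    rw [lost, degree_eq_sum_ite]
    refine Finset.sum_eq_zero fun x _ => if_neg fun hx => (hempty (.inr hx.1)).2 hx.2
  have hgained : gained e j = 0 := by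
    have hpos : ¬(pathGraph (n + 1)).Adj j (e.symm 0) := fun h =>
      (hempty (.inr h)).1 (e.apply_symm_apply 0)
    have hzero := hempty (.inl rfl)
    simp [gained, hpos, hzero]
  omega

theorem lost_add_gained_le_card_hits (hj : j ∉ cluster 0)
    (hej : ¬(pathGraph (n + 1)).Adj 0 (e j)) : lost e j + gained e j ≤ (hits e j).card := by
  have hgained : gained e j = ∑ x, ((if x = e.symm 0 ∧ (pathGraph (n + 1)).Adj j x then 1 else 0) +
      if x = 0 ∧ (pathGraph (n + 1)).Adj (e j) (e x) then 1 else 0) := by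
    have hj0 : j ≠ 0 := fun h => hj (mem_cluster.2 (.inl h))
    simp [gained, Finset.sum_add_distrib, ite_and, hj0]
  have hcard : (hits e j).card = ∑ x, if x ∈ hits e j then 1 else 0 := by simp
  rw [lost, degree_eq_sum_ite, hgained, ← Finset.sum_add_distrib, hcard]
  refine Finset.sum_le_sum fun x _ => ?_
  simp only [mem_cluster, not_or, (pathGraph (n + 1)).adj_comm 0] at hj hej
  simp only [hits, Finset.mem_filter, mem_cluster, adjacencyGraph_adj, Equiv.eq_symm_apply]
  grind

theorem two_le_card_hits_or (hj : j ∉ cluster 0) (h : 2 ≤ lost e j + gained e j) :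
    2 ≤ (hits e j).card ∨ (pathGraph (n + 1)).Adj 0 (e j) ∧ (hits e j).Nonempty := by
  by_cases hej : (pathGraph (n + 1)).Adj 0 (e j)
  · exact .inr ⟨hej, hits_nonempty_of_lost_add_gained_ne_zero (by omega)⟩
  · exact .inl (h.trans (lost_add_gained_le_card_hits hj hej))

end Deterministic

section Probability

variable {θ : ℝ} (hθ : 0 < θ) (hn : 2 ≤ n)
include hθ hn

theorem measureReal_apply_mem_le (x : Fin (n + 1)) {T : Finset (Fin (n + 1))} (hT : T.card ≤ 3) :
    (ewensMeasure θ (n + 1)).real {e | e x ∈ T} ≤ 9 * max θ θ⁻¹ / ↑(n + 1) := by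
  have := isProbabilityMeasure_ewensMeasure hθ (n + 1)
  simpa using measureReal_and_apply_mem_le_div (x := x) hθ (by omega) (X := ∅) (by simp)
    (Finset.notMem_empty x) (B := .univ) (T := fun _ => T) (fun _ _ _ => id) (fun _ _ _ => rfl)
    fun _ => hT

theorem measureReal_apply_eq_le (x y : Fin (n + 1)) :
    (ewensMeasure θ (n + 1)).real {e | e x = y} ≤ 9 * max θ θ⁻¹ / ↑(n + 1) := by
  simpa using measureReal_apply_mem_le hθ hn x (T := {y}) (by simp)

theorem measureReal_and_mem_hits_le {X : Finset (Fin (n + 1))} (hX : X.card ≤ 2)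
    {j x : Fin (n + 1)} (hj : j ∈ X) (hx : x ∉ X) {B : Set (Equiv.Perm (Fin (n + 1)))}
    (hB : ∀ e e' : Equiv.Perm (Fin (n + 1)), Set.EqOn e e' X → e ∈ B → e' ∈ B) :
    (ewensMeasure θ (n + 1)).real {e | e ∈ B ∧ x ∈ hits e j} ≤
      9 * max θ θ⁻¹ / ↑(n + 1) * (ewensMeasure θ (n + 1)).real B :=
  (measureReal_mono fun _ he => And.imp_right (fun h => (Finset.mem_filter.1 h).2) he).trans <|
    measureReal_and_apply_mem_le_div hθ (by omega) hX hx hB (T := fun e => cluster (e j))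
      (fun e e' h => by rw [h hj]) fun e => card_cluster_le (e j)

theorem measureReal_mem_hits_le (x j : Fin (n + 1)) :
    (ewensMeasure θ (n + 1)).real {e | x ∈ hits e j} ≤ 9 * max θ θ⁻¹ / ↑(n + 1) := by
  have := isProbabilityMeasure_ewensMeasure hθ (n + 1)
  rcases eq_or_ne x j with rfl | hxj
  · refine (measureReal_mono fun e he => ?_).trans (measureReal_apply_eq_le hθ hn 0 0)
    have ⟨hx, hex⟩ := Finset.mem_filter.1 (show x ∈ hits e x from he)
    rw [self_mem_cluster_iff] at hx hex
    exact hx ▸ hex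
  · simpa using measureReal_and_mem_hits_le hθ hn (X := {j}) (by simp) (by simp)
      (by simpa using hxj) (B := .univ) fun _ _ _ => id

theorem measureReal_hits_nonempty_le (j : Fin (n + 1)) :
    (ewensMeasure θ (n + 1)).real {e | (hits e j).Nonempty} ≤
      3 * (9 * max θ θ⁻¹ / ↑(n + 1)) := by
  have hsub : {e | (hits e j).Nonempty} ⊆ ⋃ x ∈ cluster j, {e | x ∈ hits e j} :=
    fun e ⟨x, hx⟩ => Set.mem_biUnion (Finset.mem_filter.1 hx).1 hx
  refine (measureReal_mono hsub (measure_ne_top _ _)).trans <|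
    (measureReal_biUnion_finset_le _ _).trans ?_
  refine (Finset.sum_le_card_nsmul _ _ _ fun x _ => measureReal_mem_hits_le hθ hn x j).trans ?_
  rw [nsmul_eq_mul]
  gcongr
  exact mod_cast card_cluster_le j

section Pairs

variable {j : Fin (n + 1)} (hj : j ≠ 0)
include hj

theorem measureReal_mem_hits_and_mem_hits_le {x y : Fin (n + 1)} (hxy : x ≠ y) :
    (ewensMeasure θ (n + 1)).real {e | x ∈ hits e j ∧ y ∈ hits e j} ≤
      (9 * max θ θ⁻¹ / ↑(n + 1)) ^ 2 := by
  have notMem_hits (e : Equiv.Perm (Fin (n + 1))) : j ∉ hits e j := fun h =>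
    hj (self_mem_cluster_iff.1 (Finset.mem_filter.1 h).1)
  by_cases hjx : x = j
  · simp [hjx, notMem_hits, sq_nonneg]
  by_cases hjy : y = j
  · simp [hjy, notMem_hits, sq_nonneg]
  have hB (e e' : Equiv.Perm (Fin (n + 1))) (h : Set.EqOn e e' ({j, x} : Finset _))
      (he : x ∈ hits e j) : x ∈ hits e' j := by
    rw [hits, Finset.mem_filter] at he ⊢
    rwa [← h (by simp), ← h (by simp)]
  refine (measureReal_and_mem_hits_le hθ hn Finset.card_le_two (by simp)
    (by simp [Ne.symm hxy, hjy]) hB).trans ?_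
  rw [sq]
  gcongr
  exact measureReal_mem_hits_le hθ hn x j

theorem measureReal_adj_and_mem_hits_le (x : Fin (n + 1)) :
    (ewensMeasure θ (n + 1)).real {e | (pathGraph (n + 1)).Adj 0 (e j) ∧ x ∈ hits e j} ≤
      (9 * max θ θ⁻¹ / ↑(n + 1)) ^ 2 := by
  by_cases hjx : x = j
  · simp [hjx, hits, self_mem_cluster_iff, hj, sq_nonneg]
  refine (measureReal_and_mem_hits_le hθ hn (X := {j}) (by simp) (by simp) (by simpa using hjx)
    (B := {e | (pathGraph (n + 1)).Adj 0 (e j)}) fun e e' h he => ?_).trans ?_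
  · rwa [Set.mem_ofPred_eq, ← h (Finset.mem_singleton_self j)]
  · rw [sq]
    gcongr
    simpa using measureReal_apply_mem_le hθ hn j (T := (pathGraph (n + 1)).neighborFinset 0)
      (by simpa using (degree_pathGraph_le_two _).trans (by norm_num))

end Pairs

theorem measureReal_two_le_lost_add_gained_le {j : Fin (n + 1)} (hj : j ∉ cluster 0) :
    (ewensMeasure θ (n + 1)).real {e | 2 ≤ lost e j + gained e j} ≤
      9 * (9 * max θ θ⁻¹ / ↑(n + 1)) ^ 2 := by
  set ε := (9 * max θ θ⁻¹ / ↑(n + 1)) ^ 2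
  have hj0 : j ≠ 0 := fun h => hj (mem_cluster.2 (.inl h))
  have hsub : {e | 2 ≤ lost e j + gained e j} ⊆
      (⋃ p ∈ (cluster j).offDiag, {e | p.1 ∈ hits e j ∧ p.2 ∈ hits e j}) ∪
        ⋃ x ∈ cluster j, {e | (pathGraph (n + 1)).Adj 0 (e j) ∧ x ∈ hits e j} := by
    intro e he
    have mem_cluster_of_mem {x} (hx : x ∈ hits e j) : x ∈ cluster j := (Finset.mem_filter.1 hx).1
    rcases two_le_card_hits_or hj he with h | ⟨hadj, x, hx⟩
    · obtain ⟨x, hx, y, hy, hxy⟩ := Finset.one_lt_card.1 h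
      exact .inl <| Set.mem_biUnion (x := (x, y))
        (Finset.mem_offDiag.2 ⟨mem_cluster_of_mem hx, mem_cluster_of_mem hy, hxy⟩) ⟨hx, hy⟩
    · exact .inr <| Set.mem_biUnion (mem_cluster_of_mem hx) ⟨hadj, hx⟩
  refine (measureReal_mono hsub (measure_ne_top _ _)).trans <| (measureReal_union_le _ _).trans <|
    (add_le_add (measureReal_biUnion_finset_le _ _) (measureReal_biUnion_finset_le _ _)).trans ?_
  have hpairs := Finset.sum_le_card_nsmul _ _ ε fun p (hp : p ∈ (cluster j).offDiag) =>
    measureReal_mem_hits_and_mem_hits_le hθ hn hj0 (Finset.mem_offDiag.1 hp).2.2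
  have hsingle := Finset.sum_le_card_nsmul (cluster j) _ ε fun x _ =>
    measureReal_adj_and_mem_hits_le hθ hn hj0 x
  have hcard : ((cluster j).offDiag.card + (cluster j).card : ℝ) ≤ 9 := by
    rw [Finset.offDiag_card, ← Nat.cast_add, Nat.sub_add_cancel (Nat.le_mul_self _)]
    exact mod_cast Nat.mul_le_mul (card_cluster_le j) (card_cluster_le j)
  refine (add_le_add hpairs hsingle).trans ?_
  rw [nsmul_eq_mul, nsmul_eq_mul, ← add_mul]
  exact mul_le_mul_of_nonneg_right hcard (sq_nonneg _)

theorem sum_measureReal_two_le_lost_add_gained_le :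
    ∑ j, (ewensMeasure θ (n + 1)).real {e | 2 ≤ lost e j + gained e j} ≤
      810 * max θ θ⁻¹ ^ 2 / ↑(n + 1) := by
  have hK : 1 ≤ max θ θ⁻¹ := one_le_max_inv hθ
  set c := 9 * max θ θ⁻¹ / ↑(n + 1) with hc
  have bound (j : Fin (n + 1)) :
      (ewensMeasure θ (n + 1)).real {e | 2 ≤ lost e j + gained e j} ≤ 3 * c :=
    (measureReal_mono fun e (he : 2 ≤ _) =>
      hits_nonempty_of_lost_add_gained_ne_zero (by omega)).trans
        (measureReal_hits_nonempty_le hθ hn j)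
  rw [← Finset.sum_add_sum_compl (cluster 0)]
  calc _ ≤ (cluster 0).card • (3 * c) + (cluster 0)ᶜ.card • (9 * c ^ 2) := by
        refine add_le_add (Finset.sum_le_card_nsmul _ _ _ fun j _ => bound j)
          (Finset.sum_le_card_nsmul _ _ _ fun j hj => ?_)
        exact measureReal_two_le_lost_add_gained_le hθ hn (Finset.mem_compl.1 hj)
    _ ≤ 3 * (3 * c) + ↑(n + 1) * (9 * c ^ 2) := by
        rw [nsmul_eq_mul, nsmul_eq_mul]
        gcongr
        · exact mod_cast card_cluster_le 0
        · exact (Finset.card_le_univ _).trans_eq (Fintype.card_fin _)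
    _ = (81 * max θ θ⁻¹ + 729 * max θ θ⁻¹ ^ 2) / ↑(n + 1) := by
        rw [hc]
        field_simp
        ring
    _ ≤ 810 * max θ θ⁻¹ ^ 2 / ↑(n + 1) := by
        gcongr
        nlinarith

end Probability

end Clusters

/-! ### Comparison with the birth–death chain -/

/-- The generator of the birth–death chain on `ℕ` with birth rate `4` and death rate `2a` at `a`,
whose stationary law is Poisson with parameter `2`. The truncated subtraction at `a = 0` is
harmless, the death rate being `0` there. -/
def birthDeath (h : ℕ → ℝ) (a : ℕ) : ℝ :=
  2 * a * (h (a - 1) - h a) + 4 * (h (a + 1) - h a)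

/-- A bound for the error made by replacing the insertion of a new smallest element into `e` by a
step of the birth–death chain: fixed new elements, end effects, and insertions changing more than
one adjacency. -/
noncomputable def stepError (θ : ℝ) {n : ℕ} (e : Equiv.Perm (Fin (n + 1))) : ℝ :=
  θ * (if e 0 = 0 then 1 else 0) + deficit e +
    6 * ∑ j, if 2 ≤ lost e j + gained e j then 1 else 0

theorem integral_stepError_le {θ : ℝ} (hθ : 0 < θ) {n : ℕ} (hn : 2 ≤ n) :
    ∫ e, stepError θ e ∂ewensMeasure θ (n + 1) ≤ 4896 * max θ θ⁻¹ ^ 2 / ↑(n + 1) := by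
  have hite (p : Equiv.Perm (Fin (n + 1)) → Prop) [DecidablePred p] :
      ∫ e, (if p e then 1 else 0 : ℝ) ∂ewensMeasure θ (n + 1) =
        (ewensMeasure θ (n + 1)).real {e | p e} := by
    rw [← integral_indicator_one .of_discrete]
    simp [Set.indicator_apply]
  have hInt (f : Equiv.Perm (Fin (n + 1)) → ℝ) : Integrable f (ewensMeasure θ (n + 1)) :=
    .of_finite
  have hθK : θ ≤ max θ θ⁻¹ := le_max_left _ _
  have hK : 1 ≤ max θ θ⁻¹ := one_le_max_inv hθ
  have hdeficit (e : Equiv.Perm (Fin (n + 1))) : (deficit e : ℝ) = (if e 0 = 0 then 1 else 0) +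
      (if e 0 = Fin.last n then 1 else 0) + if e (Fin.last n) = 0 then 1 else 0 := by
    simp [deficit]
  simp only [stepError, hdeficit, integral_add (hInt _) (hInt _), integral_const_mul,
    integral_finsetSum _ fun _ _ => hInt _, hite]
  calc _ ≤ max θ θ⁻¹ * (9 * max θ θ⁻¹ / ↑(n + 1)) + (9 * max θ θ⁻¹ / ↑(n + 1) +
        9 * max θ θ⁻¹ / ↑(n + 1) + 9 * max θ θ⁻¹ / ↑(n + 1)) +
        6 * (810 * max θ θ⁻¹ ^ 2 / ↑(n + 1)) := by
        gcongr
        · exact measureReal_apply_eq_le hθ hn _ _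
        · exact measureReal_apply_eq_le hθ hn _ _
        · exact measureReal_apply_eq_le hθ hn _ _
        · exact measureReal_apply_eq_le hθ hn _ _
        · exact sum_measureReal_two_le_lost_add_gained_le hθ hn
    _ = (4869 * max θ θ⁻¹ ^ 2 + 27 * max θ θ⁻¹) / ↑(n + 1) := by ring
    _ ≤ 4896 * max θ θ⁻¹ ^ 2 / ↑(n + 1) := by
        gcongr
        nlinarith

section OneStep

variable {h : ℕ → ℝ} (h0 : ∀ a, 0 ≤ h a) (h1 : ∀ a, h a ≤ 1)
include h0 h1

theorem abs_jump_sub_linear_le {a b l g : ℕ} (hb : b + l = a + g) (hl : l ≤ 2) (hg : g ≤ 3) :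
    |h b - h a - (l * (h (a - 1) - h a) + g * (h (a + 1) - h a))| ≤
      if 2 ≤ l + g then 6 else 0 := by
  split_ifs with hlg
  · have hlR : (l : ℝ) ≤ 2 := mod_cast hl
    have hgR : (g : ℝ) ≤ 3 := mod_cast hg
    calc _ ≤ |h b - h a| + (|l * (h (a - 1) - h a)| + |g * (h (a + 1) - h a)|) :=
          (abs_sub _ _).trans (by gcongr; exact abs_add_le _ _)
      _ ≤ 1 + (2 * 1 + 3 * 1) := by
          rw [abs_mul, abs_mul, Nat.abs_cast, Nat.abs_cast]
          gcongr <;> exact abs_sub_le_of_nonneg_of_le (h0 _) (h1 _) (h0 _) (h1 _)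
      _ = 6 := by norm_num
  · obtain ⟨rfl, rfl⟩ | ⟨rfl, rfl⟩ | ⟨rfl, rfl⟩ : l = 0 ∧ g = 0 ∨ l = 1 ∧ g = 0 ∨ l = 0 ∧ g = 1 :=
      by omega
    · simp [show b = a by omega]
    · simp [show b = a - 1 by omega]
    · simp [show b = a + 1 by omega]

variable {θ : ℝ} (hθ : 0 < θ) {n : ℕ}
include hθ

theorem abs_insertion_sub_birthDeath_le (e : Equiv.Perm (Fin (n + 1))) :
    |(θ * h (numAdjacencies (insertFixed e)) + ∑ j, h (numAdjacencies (insertAfter e j))) -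
        ((θ + ↑(n + 1)) * h (numAdjacencies e) + birthDeath h (numAdjacencies e))| ≤
      stepError θ e := by
  set a := numAdjacencies e with ha
  set down := h (a - 1) - h a
  set up := h (a + 1) - h a
  have hfixed : |θ * (h (numAdjacencies (insertFixed e)) - h a)| ≤
      θ * if e 0 = 0 then 1 else 0 := by
    rw [abs_mul, abs_of_pos hθ, numAdjacencies_insertFixed]
    gcongr
    split_ifs
    · exact abs_sub_le_of_nonneg_of_le (h0 _) (h1 _) (h0 _) (h1 _)
    · simp [ha]
  have hdeficit : |deficit e * up| ≤ deficit e := by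
    rw [abs_mul, Nat.abs_cast]
    exact mul_le_of_le_one_right (Nat.cast_nonneg _)
      (abs_sub_le_of_nonneg_of_le (h0 _) (h1 _) (h0 _) (h1 _))
  have hjump : |∑ j, (h (numAdjacencies (insertAfter e j)) - h a -
      (lost e j * down + gained e j * up))| ≤
      6 * ∑ j, if 2 ≤ lost e j + gained e j then 1 else 0 := by
    rw [Finset.mul_sum]
    refine (Finset.abs_sum_le_sum_abs _ _).trans (Finset.sum_le_sum fun j _ => ?_)
    simpa using abs_jump_sub_linear_le h0 h1 (numAdjacencies_insertAfter_add_lost e j)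
      (lost_le_two e j) (gained_le_three e j)
  have hlost : ∑ j, (lost e j : ℝ) = 2 * a := mod_cast sum_lost e
  have hgained : ∑ j, (gained e j : ℝ) = 4 - deficit e :=
    eq_sub_of_add_eq (mod_cast sum_gained_add_deficit e)
  simp only [Finset.sum_sub_distrib, Finset.sum_add_distrib, ← Finset.sum_mul, hlost, hgained,
    Finset.sum_const, Finset.card_univ, Fintype.card_fin, nsmul_eq_mul] at hjump
  refine le_trans (le_of_eq (congrArg abs ?_)) <| (abs_add_three _ _ _).trans <|
    add_le_add (add_le_add hfixed ((abs_neg _).trans_le hdeficit)) hjump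
  simp only [birthDeath, down, up]
  ring

theorem abs_integral_succ_sub_birthDeath_le (hn : 2 ≤ n) :
    |∫ σ, h (numAdjacencies σ) ∂ewensMeasure θ (n + 2) -
        ∫ e, (h (numAdjacencies e) + (θ + ↑(n + 1))⁻¹ * birthDeath h (numAdjacencies e))
          ∂ewensMeasure θ (n + 1)| ≤
      4896 * max θ θ⁻¹ ^ 2 / ↑(n + 1) ^ 2 := by
  have hs : 0 < θ + ↑(n + 1) := by positivity
  have hInt (f : Equiv.Perm (Fin (n + 1)) → ℝ) : Integrable f (ewensMeasure θ (n + 1)) :=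
    .of_finite
  rw [integral_ewensMeasure_succ hθ, ← integral_const_mul, ← integral_sub (hInt _) (hInt _)]
  have hfactor (x y z : ℝ) : (θ + ↑(n + 1))⁻¹ * x - (y + (θ + ↑(n + 1))⁻¹ * z) =
      (θ + ↑(n + 1))⁻¹ * (x - ((θ + ↑(n + 1)) * y + z)) := by
    field_simp
  calc _ ≤ ∫ e : Equiv.Perm (Fin (n + 1)), (θ + ↑(n + 1))⁻¹ * stepError θ e
          ∂ewensMeasure θ (n + 1) := by
        refine abs_integral_le_integral_abs.trans <| integral_mono (hInt _) (hInt _) fun e => ?_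
        dsimp only
        rw [hfactor, abs_mul, abs_of_pos (inv_pos.2 hs)]
        gcongr
        exact abs_insertion_sub_birthDeath_le h0 h1 hθ e
    _ ≤ (θ + ↑(n + 1))⁻¹ * (4896 * max θ θ⁻¹ ^ 2 / ↑(n + 1)) := by
        rw [integral_const_mul]
        gcongr
        exact integral_stepError_le hθ hn
    _ ≤ (↑(n + 1))⁻¹ * (4896 * max θ θ⁻¹ ^ 2 / ↑(n + 1)) := by
        gcongr
        linarith
    _ = _ := by ring

end OneStep

/-! ### The birth–death chain on generating functions -/

theorem choose_mul_pow_mul_pow_le_one {v : ℝ} (h0 : 0 ≤ v) (h1 : v ≤ 1) (a k : ℕ) :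
    (a.choose k : ℝ) * (v ^ k * (1 - v) ^ (a - k)) ≤ 1 := by
  rcases lt_or_ge a k with hak | hka
  · simp [Nat.choose_eq_zero_of_lt hak]
  have : 0 ≤ 1 - v := sub_nonneg.2 h1
  calc (a.choose k : ℝ) * (v ^ k * (1 - v) ^ (a - k))
      = v ^ k * (1 - v) ^ (a - k) * a.choose k := mul_comm _ _
    _ ≤ ∑ m ∈ Finset.range (a + 1), v ^ m * (1 - v) ^ (a - m) * a.choose m :=
        Finset.single_le_sum (f := fun m => v ^ m * (1 - v) ^ (a - m) * (a.choose m : ℝ))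
          (fun m _ => by positivity) (Finset.mem_range.2 (Nat.lt_succ_of_le hka))
    _ = 1 := by rw [← add_pow, add_sub_cancel, one_pow]

theorem add_pow_sub_linear_mem_Icc {x t : ℝ} (hx : 0 ≤ x) (ht : 0 ≤ t) (a : ℕ) :
    (x + t) ^ a - (x ^ a + a * (t * x ^ (a - 1))) ∈
      Set.Icc 0 (a.choose 2 * (t ^ 2 * (x + t) ^ (a - 2))) := by
  induction a with
  | zero => simp
  | succ a ih =>
    rcases a with _ | a
    · simp
    have hstep : (x + t) ^ (a + 2) - (x ^ (a + 2) + ↑(a + 2) * (t * x ^ (a + 1))) =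
        (x + t) * ((x + t) ^ (a + 1) - (x ^ (a + 1) + ↑(a + 1) * (t * x ^ a))) +
          ↑(a + 1) * (t ^ 2 * x ^ a) := by
      push_cast; ring
    have hpow : ((a + 1).choose 2 : ℝ) * (x + t) ^ a =
        (x + t) * ((a + 1).choose 2 * (x + t) ^ (a - 1)) := by
      rcases a with _ | a
      · simp
      · simp only [Nat.add_sub_cancel]; ring
    have hxt : 0 ≤ x + t := add_nonneg hx ht
    simp only [Nat.add_sub_cancel, Nat.reduceSubDiff] at ih ⊢
    rw [hstep]
    refine ⟨add_nonneg (mul_nonneg hxt ih.1) (by positivity), ?_⟩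
    calc _ ≤ (x + t) * ((a + 1).choose 2 * (t ^ 2 * (x + t) ^ (a - 1))) +
          ↑(a + 1) * (t ^ 2 * (x + t) ^ a) := by
          gcongr
          · exact ih.2
          · linarith
      _ = _ := by
          rw [Nat.choose_succ_succ' (a + 1) 1, Nat.choose_one_right]
          push_cast
          linear_combination (-t ^ 2) * hpow

theorem exp_neg_sub_linear_mem_Icc {y : ℝ} (hy : 0 ≤ y) :
    Real.exp (-y) - (1 - y) ∈ Set.Icc 0 (y ^ 2) := by
  refine ⟨sub_nonneg.2 (Real.one_sub_le_exp_neg y), ?_⟩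
  have h : Real.exp (-y) ≤ (1 + y)⁻¹ := by
    rw [Real.exp_neg]
    gcongr
    linarith [Real.add_one_le_exp y]
  calc Real.exp (-y) - (1 - y) ≤ (1 + y)⁻¹ - (1 - y) := by gcongr
    _ = y ^ 2 * (1 + y)⁻¹ := by field_simp; ring
    _ ≤ y ^ 2 := mul_le_of_le_one_right (sq_nonneg y) (inv_le_one_of_one_le₀ (by linarith))

theorem add_mul_birthDeath_pow (s u : ℝ) (a : ℕ) :
    (1 - u) ^ a + s * birthDeath (fun b => (1 - u) ^ b) a =
      (1 - 2 * (2 * s * u)) * (1 - u) ^ a + a * (2 * s * u * (1 - u) ^ (a - 1)) := by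
  unfold birthDeath
  rcases a with _ | a
  · simp; ring
  · simp only [Nat.add_sub_cancel]
    ring

theorem abs_pow_sub_linear_le {s u : ℝ} (hs : 0 ≤ s) (hs' : s ≤ 1 / 3) (hu : 0 ≤ u) (hu' : u ≤ 1)
    (a : ℕ) :
    |(1 - (1 - 2 * s) * u) ^ a - ((1 - u) ^ a + a * (2 * s * u * (1 - u) ^ (a - 1)))| ≤
      36 * s ^ 2 := by
  have ht : 0 ≤ 2 * s * u := by positivity
  set w := (1 - 2 * s) * u with hw
  have hw0 : 0 ≤ w := mul_nonneg (by linarith) hu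
  have hw1 : w ≤ 1 := mul_le_one₀ (by linarith) hu hu'
  have htw : 2 * s * u ≤ 6 * s * w := by
    have : u ≤ 3 * w := by nlinarith
    nlinarith
  obtain ⟨hpow0, hpow⟩ := add_pow_sub_linear_mem_Icc (sub_nonneg.2 hu') ht a
  rw [show 1 - u + 2 * s * u = 1 - w by rw [hw]; ring] at hpow0 hpow
  rw [abs_of_nonneg hpow0]
  calc _ ≤ a.choose 2 * ((2 * s * u) ^ 2 * (1 - w) ^ (a - 2)) := hpow
    _ ≤ a.choose 2 * ((6 * s * w) ^ 2 * (1 - w) ^ (a - 2)) := by gcongr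
    _ = 36 * s ^ 2 * (a.choose 2 * (w ^ 2 * (1 - w) ^ (a - 2))) := by ring
    _ ≤ 36 * s ^ 2 := mul_le_of_le_one_right (by positivity)
        (choose_mul_pow_mul_pow_le_one hw0 hw1 a 2)

/-- To first order in the step size `s`, a step of the birth–death chain maps `a ↦ (1 - u) ^ a`
to a multiple of such a function with `u` replaced by `(1 - 2 * s) * u`. -/
theorem abs_add_mul_birthDeath_pow_sub_le {s u : ℝ} (hs : 0 ≤ s) (hs' : s ≤ 1 / 3) (hu : 0 ≤ u)
    (hu' : u ≤ 1) (a : ℕ) :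
    |(1 - u) ^ a + s * birthDeath (fun b => (1 - u) ^ b) a -
      Real.exp (-(2 * (2 * s * u))) * (1 - (1 - 2 * s) * u) ^ a| ≤ 60 * s ^ 2 := by
  set t := 2 * s * u with ht
  have ht0 : 0 ≤ t := by positivity
  have hts : t ≤ 2 * s := mul_le_of_le_one_right (by positivity) hu'
  have hw0 : 0 ≤ (1 - 2 * s) * u := mul_nonneg (by linarith) hu
  have hw1 : 0 ≤ 1 - (1 - 2 * s) * u := sub_nonneg.2 (mul_le_one₀ (by linarith) hu hu')
  have hquad := abs_pow_sub_linear_le hs hs' hu hu' a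
  obtain ⟨hexp0, hexp⟩ := exp_neg_sub_linear_mem_Icc (mul_nonneg zero_le_two ht0)
  have hlin : |a * (t * (1 - u) ^ (a - 1))| ≤ 2 * s := by
    have : 0 ≤ 1 - u := sub_nonneg.2 hu'
    rw [abs_of_nonneg (by positivity)]
    calc a * (t * (1 - u) ^ (a - 1)) = 2 * s * (a.choose 1 * (u ^ 1 * (1 - u) ^ (a - 1))) := by
          rw [ht, Nat.choose_one_right]; ring
      _ ≤ 2 * s := mul_le_of_le_one_right (by positivity)
          (choose_mul_pow_mul_pow_le_one hu hu' a 1)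
  have hexpt : |Real.exp (-(2 * t)) - (1 - 2 * t)| ≤ 16 * s ^ 2 := by
    rw [abs_of_nonneg hexp0]
    nlinarith
  calc _ = |2 * t * (a * (t * (1 - u) ^ (a - 1))) -
        (1 - 2 * t) *
          ((1 - (1 - 2 * s) * u) ^ a - ((1 - u) ^ a + a * (t * (1 - u) ^ (a - 1)))) -
        (Real.exp (-(2 * t)) - (1 - 2 * t)) * (1 - (1 - 2 * s) * u) ^ a| := by
        rw [add_mul_birthDeath_pow]
        congr 1
        ring
    _ ≤ 2 * (2 * s) * (2 * s) + 1 * (36 * s ^ 2) + 16 * s ^ 2 * 1 := by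
        refine (abs_sub _ _).trans (add_le_add ((abs_sub _ _).trans (add_le_add ?_ ?_)) ?_) <;>
          rw [abs_mul]
        · rw [abs_of_nonneg (by positivity : 0 ≤ 2 * t)]
          gcongr
        · gcongr
          exact abs_le.2 ⟨by linarith, by linarith⟩
        · gcongr
          rw [abs_of_nonneg (pow_nonneg hw1 a)]
          exact pow_le_one₀ hw1 (by linarith)
    _ = 60 * s ^ 2 := by ring

/-! ### Convergence of the generating functions -/

theorem tendsto_prod_one_sub_zero {s : ℕ → ℝ} (h0 : ∀ n, 0 ≤ s n) (h1 : ∀ n, s n ≤ 1)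
    (hs : ¬Summable s) :
    Tendsto (fun n => ∏ i ∈ Finset.range n, (1 - s i)) atTop (nhds 0) := by
  have hexp : Tendsto (fun n => Real.exp (-∑ i ∈ Finset.range n, s i)) atTop (nhds 0) :=
    Real.tendsto_exp_neg_atTop_nhds_zero.comp <|
      (not_summable_iff_tendsto_nat_atTop_of_nonneg h0).1 hs
  refine squeeze_zero (fun n => Finset.prod_nonneg fun i _ => sub_nonneg.2 (h1 i))
    (fun n => ?_) hexp
  rw [← Finset.sum_neg_distrib, Real.exp_sum]
  exact Finset.prod_le_prod (fun i _ => sub_nonneg.2 (h1 i)) fun i _ => Real.one_sub_le_exp_neg _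

section Contraction

variable {D : ℕ → ℝ → ℝ} {s ε : ℕ → ℝ} (h0 : ∀ n, 0 ≤ s n) (h1 : ∀ n, s n ≤ 1)
  (hD : ∀ n, ∀ u ∈ Set.Icc (0 : ℝ) 1, |D (n + 1) u| ≤ |D n ((1 - s n) * u)| + ε n)
include h0 h1 hD

theorem abs_le_abs_prod_mul_add_sum (m k : ℕ) {u : ℝ} (hu : u ∈ Set.Icc (0 : ℝ) 1) :
    |D (m + k) u| ≤
      |D m ((∏ i ∈ Finset.range k, (1 - s (m + i))) * u)| + ∑ i ∈ Finset.range k, ε (m + i) := by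
  induction k generalizing u with
  | zero => simp
  | succ k ih =>
    have hu' : (1 - s (m + k)) * u ∈ Set.Icc (0 : ℝ) 1 :=
      ⟨mul_nonneg (sub_nonneg.2 (h1 _)) hu.1,
        mul_le_one₀ (sub_le_self _ (h0 _)) hu.1 hu.2⟩
    rw [Finset.prod_range_succ, Finset.sum_range_succ, mul_assoc, ← add_assoc, ← add_assoc]
    exact (hD _ u hu).trans (add_le_add_left (ih hu') _)

theorem tendsto_zero_of_contraction (hs : ¬Summable s) (hε : Summable ε) (hε0 : ∀ n, 0 ≤ ε n)
    (hcont : ∀ n, ContinuousAt (D n) 0) (hzero : ∀ n, D n 0 = 0) {u : ℝ}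
    (hu : u ∈ Set.Icc (0 : ℝ) 1) : Tendsto (fun n => D n u) atTop (nhds 0) := by
  rw [Metric.tendsto_atTop]
  intro δ hδ
  obtain ⟨m, hm⟩ := ((tendsto_sum_nat_add ε).eventually_lt_const (half_pos hδ)).exists
  have hprod : Tendsto (fun k => (∏ i ∈ Finset.range k, (1 - s (m + i))) * u) atTop (nhds 0) := by
    simpa using (tendsto_prod_one_sub_zero (fun i => h0 (m + i)) (fun i => h1 (m + i))
      (by simpa only [add_comm m] using mt (summable_nat_add_iff m).1 hs)).mul_const u
  have hlim : Tendsto (fun k => |D m ((∏ i ∈ Finset.range k, (1 - s (m + i))) * u)|) atTop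
      (nhds 0) := by
    simpa [hzero] using ((hcont m).tendsto.comp hprod).abs
  obtain ⟨K, hK⟩ := eventually_atTop.1 (hlim.eventually_lt_const (half_pos hδ))
  refine ⟨m + K, fun n hn => ?_⟩
  obtain ⟨k, rfl⟩ := Nat.exists_eq_add_of_le ((Nat.le_add_right m K).trans hn)
  have hsum : ∑ i ∈ Finset.range k, ε (m + i) ≤ ∑' i, ε (i + m) := by
    simp only [add_comm m]
    exact ((summable_nat_add_iff m).2 hε).sum_le_tsum _ fun i _ => hε0 _
  rw [Real.dist_0_eq_abs]
  linarith [abs_le_abs_prod_mul_add_sum h0 h1 hD m k hu, hK k (by omega)]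

end Contraction

/-- The difference between the probability generating function, at `1 - u`, of the number of
adjacencies of an Ewens permutation of `N` points and that of the Poisson law with parameter `2`. -/
noncomputable def pgfError (θ : ℝ) (N : ℕ) (u : ℝ) : ℝ :=
  ∫ σ, (1 - u) ^ numAdjacencies σ ∂ewensMeasure θ N - Real.exp (-(2 * u))

theorem continuous_pgfError (θ : ℝ) (N : ℕ) : Continuous (pgfError θ N) := by
  unfold pgfError
  simp only [integral_fintype .of_finite]
  fun_prop

section Limit

variable {θ : ℝ} (hθ : 0 < θ)
include hθ

theorem abs_integral_pow_succ_sub_le {n : ℕ} (hn : 2 ≤ n) {u : ℝ} (hu : 0 ≤ u) (hu' : u ≤ 1) :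
    |∫ σ, (1 - u) ^ numAdjacencies σ ∂ewensMeasure θ (n + 2) -
      Real.exp (-(2 * (2 * (θ + ↑(n + 1))⁻¹ * u))) *
        ∫ σ, (1 - (1 - 2 * (θ + ↑(n + 1))⁻¹) * u) ^ numAdjacencies σ ∂ewensMeasure θ (n + 1)| ≤
      4956 * max θ θ⁻¹ ^ 2 / ↑(n + 1) ^ 2 := by
  have := isProbabilityMeasure_ewensMeasure hθ (n + 1)
  set s := (θ + ↑(n + 1))⁻¹ with hs
  have hs0 : 0 ≤ s := by positivity
  have hsn : s ≤ (↑(n + 1))⁻¹ := by rw [hs]; gcongr; linarith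
  have hs3 : s ≤ 1 / 3 := hsn.trans <| by
    rw [one_div]; gcongr; exact_mod_cast Nat.succ_le_succ hn
  have hInt (f : Equiv.Perm (Fin (n + 1)) → ℝ) : Integrable f (ewensMeasure θ (n + 1)) :=
    .of_finite
  have hstep := abs_integral_succ_sub_birthDeath_le (h := fun a => (1 - u) ^ a)
    (fun a => pow_nonneg (sub_nonneg.2 hu') a)
    (fun a => pow_le_one₀ (sub_nonneg.2 hu') (by linarith)) hθ hn
  have hflow : |∫ σ, ((1 - u) ^ numAdjacencies σ +
        s * birthDeath (fun b => (1 - u) ^ b) (numAdjacencies σ)) ∂ewensMeasure θ (n + 1) -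
      Real.exp (-(2 * (2 * s * u))) * ∫ σ, (1 - (1 - 2 * s) * u) ^ numAdjacencies σ
        ∂ewensMeasure θ (n + 1)| ≤ 60 * s ^ 2 := by
    rw [← integral_const_mul, ← integral_sub (hInt _) (hInt _)]
    have := norm_integral_le_of_norm_le_const (μ := ewensMeasure θ (n + 1)) <| ae_of_all _
      fun σ => (Real.norm_eq_abs _).trans_le
        (abs_add_mul_birthDeath_pow_sub_le hs0 hs3 hu hu' (numAdjacencies σ))
    simpa using this
  have hsq : 60 * s ^ 2 ≤ 60 * max θ θ⁻¹ ^ 2 / ↑(n + 1) ^ 2 := by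
    rw [mul_div_assoc, ← div_pow]
    gcongr
    rw [div_eq_mul_inv]
    exact hsn.trans (le_mul_of_one_le_left (by positivity) (one_le_max_inv hθ))
  calc _ ≤ 4896 * max θ θ⁻¹ ^ 2 / ↑(n + 1) ^ 2 + 60 * max θ θ⁻¹ ^ 2 / ↑(n + 1) ^ 2 :=
        (abs_sub_le _ _ _).trans (add_le_add hstep (hflow.trans hsq))
    _ = _ := by ring

theorem abs_pgfError_succ_le {n : ℕ} (hn : 2 ≤ n) {u : ℝ} (hu : 0 ≤ u) (hu' : u ≤ 1) :
    |pgfError θ (n + 2) u| ≤ |pgfError θ (n + 1) ((1 - 2 * (θ + ↑(n + 1))⁻¹) * u)| +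
      4956 * max θ θ⁻¹ ^ 2 / ↑(n + 1) ^ 2 := by
  have hstep := abs_integral_pow_succ_sub_le hθ hn hu hu'
  set s := (θ + ↑(n + 1))⁻¹
  have hexp : Real.exp (-(2 * (2 * s * u))) * Real.exp (-(2 * ((1 - 2 * s) * u))) =
      Real.exp (-(2 * u)) := by
    rw [← Real.exp_add]; ring_nf
  have hexp1 : Real.exp (-(2 * (2 * s * u))) ≤ 1 := Real.exp_le_one_iff.2 <| by
    rw [Left.neg_nonpos_iff]; positivity
  calc _ = |Real.exp (-(2 * (2 * s * u))) * pgfError θ (n + 1) ((1 - 2 * s) * u) +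
        (∫ σ, (1 - u) ^ numAdjacencies σ ∂ewensMeasure θ (n + 2) -
          Real.exp (-(2 * (2 * s * u))) *
            ∫ σ, (1 - (1 - 2 * s) * u) ^ numAdjacencies σ ∂ewensMeasure θ (n + 1))| := by
        rw [pgfError, pgfError, ← hexp]
        congr 1
        ring
    _ ≤ _ := by
        refine (abs_add_le _ _).trans (add_le_add ?_ hstep)
        rw [abs_mul, Real.abs_exp]
        exact mul_le_of_le_one_left (abs_nonneg _) hexp1

theorem pgfError_zero (N : ℕ) : pgfError θ N 0 = 0 := by
  have := isProbabilityMeasure_ewensMeasure hθ N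
  simp [pgfError]

theorem not_summable_two_mul_inv : ¬Summable fun k : ℕ => 2 * (θ + ↑(k + 3))⁻¹ := by
  have h := mt (Real.summable_one_div_nat_add_rpow (θ + 3) 1).1 (lt_irrefl 1)
  rw [← summable_mul_left_iff (two_ne_zero (α := ℝ))] at h
  refine fun hs => h (hs.congr fun k => ?_)
  rw [Real.rpow_one, one_div, abs_of_pos (by positivity)]
  push_cast
  ring

theorem tendsto_pgfError {u : ℝ} (hu : u ∈ Set.Icc (0 : ℝ) 1) :
    Tendsto (fun N => pgfError θ N u) atTop (nhds 0) := by
  have hs0 (k : ℕ) : 0 ≤ 2 * (θ + ↑(k + 3))⁻¹ := by positivity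
  have hs1 (k : ℕ) : 2 * (θ + ↑(k + 3))⁻¹ ≤ 1 := by
    rw [← div_eq_mul_inv, div_le_one (by positivity)]
    push_cast
    linarith [(k.cast_nonneg : (0 : ℝ) ≤ k)]
  have hε : Summable fun k : ℕ => 4956 * max θ θ⁻¹ ^ 2 / (↑(k + 3) : ℝ) ^ 2 := by
    simpa [div_eq_mul_inv] using (summable_nat_add_iff 3).2
      ((Real.summable_one_div_nat_pow (p := 2)).2 one_lt_two) |>.mul_left (4956 * max θ θ⁻¹ ^ 2)
  have hstep (k : ℕ) (u : ℝ) (hu : u ∈ Set.Icc (0 : ℝ) 1) : |pgfError θ (k + 1 + 3) u| ≤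
      |pgfError θ (k + 3) ((1 - 2 * (θ + ↑(k + 3))⁻¹) * u)| +
        4956 * max θ θ⁻¹ ^ 2 / ↑(k + 3) ^ 2 :=
    abs_pgfError_succ_le hθ (Nat.le_add_left 2 k) hu.1 hu.2
  exact (tendsto_add_atTop_iff_nat 3).1 <| tendsto_zero_of_contraction
    (D := fun k => pgfError θ (k + 3)) hs0 hs1 hstep (not_summable_two_mul_inv hθ) hε
    (fun k => by positivity) (fun k => (continuous_pgfError θ _).continuousAt)
    (fun k => pgfError_zero hθ _) hu

theorem tendsto_integral_pow_numAdjacencies {z : ℝ} (hz : z ∈ Set.Icc (0 : ℝ) 1) :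
    Tendsto (fun N => ∫ σ, z ^ numAdjacencies σ ∂ewensMeasure θ N) atTop
      (nhds (Real.exp (2 * (z - 1)))) := by
  have h := (tendsto_pgfError hθ (Set.Icc.mem_iff_one_sub_mem.1 hz)).add_const
    (Real.exp (2 * (z - 1)))
  simpa [pgfError, mul_sub] using h

end Limit

/-! ### From generating functions to convergence in distribution -/

theorem integral_pow_poissonMeasure (r : NNReal) (z : ℝ) :
    ∫ k, z ^ k ∂poissonMeasure r = Real.exp (r * (z - 1)) := by
  have h := (NormedSpace.expSeries_div_hasSum_exp ((r : ℝ) * z)).mul_left (Real.exp (-r))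
  rw [← Real.exp_eq_exp_ℝ, ← Real.exp_add] at h
  rw [integral_poissonMeasure, show (r : ℝ) * (z - 1) = -r + r * z by ring, ← h.tsum_eq]
  refine tsum_congr fun k => ?_
  rw [smul_eq_mul, mul_pow]
  ring

theorem abs_integral_pow_sub_sum_le (μ : Measure ℕ) [IsProbabilityMeasure μ] {z : ℝ}
    (hz : z ∈ Set.Icc (0 : ℝ) 1) (m : ℕ) :
    |∫ k, z ^ k ∂μ - ∑ j ∈ Finset.range m, μ.real {j} * z ^ j| ≤ z ^ m := by
  have norm_pow (k : ℕ) : ‖z ^ k‖ = z ^ k := Real.norm_of_nonneg (pow_nonneg hz.1 k)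
  have hInt : Integrable (fun k : ℕ => z ^ k) μ := .of_bound (C := 1) (by fun_prop) <|
    ae_of_all _ fun k => (norm_pow k).trans_le (pow_le_one₀ hz.1 hz.2)
  have hhead := setIntegral_finset (μ := μ) (Finset.range m) (f := fun k : ℕ => z ^ k)
    hInt.integrableOn
  simp only [smul_eq_mul] at hhead
  rw [← hhead, ← integral_add_compl (Finset.range m).measurableSet hInt, add_sub_cancel_left]
  have htail : ‖∫ k in (Finset.range m : Set ℕ)ᶜ, z ^ k ∂μ‖ ≤ z ^ m * μ.real _ :=
    norm_setIntegral_le_of_norm_le_const (measure_lt_top _ _) fun k hk =>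
      (norm_pow k).trans_le (pow_le_pow_of_le_one hz.1 hz.2 (by simpa using hk))
  exact htail.trans (mul_le_of_le_one_right (pow_nonneg hz.1 m) measureReal_le_one)

section GeneratingFunction

variable {ι : Type*} {l : Filter ι}

theorem tendsto_measureReal_singleton_of_tendsto_integral_pow {μ : ι → Measure ℕ}
    [∀ i, IsProbabilityMeasure (μ i)] {ρ : Measure ℕ} [IsProbabilityMeasure ρ]
    (h : ∀ z ∈ Set.Icc (0 : ℝ) 1, Tendsto (fun i => ∫ k, z ^ k ∂μ i) l (nhds (∫ k, z ^ k ∂ρ)))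
    (m : ℕ) : Tendsto (fun i => (μ i).real {m}) l (nhds (ρ.real {m})) := by
  induction m using Nat.strong_induction_on with
  | _ m ih =>
    rw [Metric.tendsto_nhds]
    intro ε hε
    -- At a small `z`, the tail of the generating function past `z ^ m` is negligible.
    obtain ⟨z, hz0, hz⟩ := exists_between (lt_min (by positivity : 0 < ε / 4) one_pos)
    obtain ⟨hzε, hz1⟩ := lt_min_iff.1 hz
    have hzI : z ∈ Set.Icc (0 : ℝ) 1 := ⟨hz0.le, hz1.le⟩
    have hlim := (h z hzI).sub <| tendsto_finsetSum (Finset.range m) fun j hj =>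
      (ih j (Finset.mem_range.1 hj)).mul_const (z ^ j)
    have hzm : 0 < z ^ m := by positivity
    filter_upwards [Metric.tendsto_nhds.1 hlim (ε / 4 * z ^ m) (by positivity)] with i hi
    have hμ := abs_le.1 (abs_integral_pow_sub_sum_le (μ i) hzI (m + 1))
    have hρ := abs_le.1 (abs_integral_pow_sub_sum_le ρ hzI (m + 1))
    rw [Finset.sum_range_succ, pow_succ] at hμ hρ
    rw [Real.dist_eq] at hi ⊢
    have hi := abs_lt.1 hi
    have htail : z ^ m * z ≤ ε / 4 * z ^ m := by nlinarith
    have : 0 < ε * z ^ m := mul_pos hε hzm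
    refine lt_of_mul_lt_mul_right ?_ hzm.le
    rw [← abs_of_pos hzm, ← abs_mul, abs_of_pos hzm, sub_mul]
    exact abs_lt.2 ⟨by linarith [hμ.1, hρ.2, hi.1], by linarith [hμ.2, hρ.1, hi.2]⟩

variable [l.IsCountablyGenerated]

theorem measure_le_liminf_of_tendsto_singleton {α : Type*} [Countable α] [MeasurableSpace α]
    [DiscreteMeasurableSpace α] {μ : ι → Measure α} {ρ : Measure α}
    (h : ∀ a, Tendsto (fun i => μ i {a}) l (nhds (ρ {a}))) (S : Set α) :
    ρ S ≤ liminf (fun i => μ i S) l := by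
  have measure_eq_lintegral (ν : Measure α) :
      ν S = ∫⁻ a, S.indicator (fun a => ν {a}) a ∂Measure.count := by
    rw [lintegral_count, Measure.tsum_indicator_apply_singleton ν S .of_discrete]
  simp only [measure_eq_lintegral]
  refine le_trans (lintegral_mono fun a => ?_) (lintegral_liminf_le fun i => .of_discrete)
  rcases l.eq_or_neBot with rfl | _
  · simp
  refine (Tendsto.liminf_eq ?_).ge
  by_cases ha : a ∈ S
  · simpa [ha] using h a
  · simp [ha]

theorem tendstoInDistribution_of_tendsto_integral_pow {Ω : ι → Type*}
    [∀ i, MeasurableSpace (Ω i)] {P : ∀ i, Measure (Ω i)} [∀ i, IsProbabilityMeasure (P i)]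
    {X : ∀ i, Ω i → ℕ} (hX : ∀ i, AEMeasurable (X i) (P i)) {ρ : Measure ℕ}
    [IsProbabilityMeasure ρ]
    (h : ∀ z ∈ Set.Icc (0 : ℝ) 1,
      Tendsto (fun i => ∫ ω, z ^ X i ω ∂P i) l (nhds (∫ k, z ^ k ∂ρ))) :
    TendstoInDistribution X l (fun k => k) P ρ where
  forall_aemeasurable := hX
  aemeasurable_limit := aemeasurable_id
  tendsto := by
    have (i : ι) : IsProbabilityMeasure ((P i).map (X i)) :=
      Measure.isProbabilityMeasure_map (hX i)
    have hpgf (z : ℝ) (hz : z ∈ Set.Icc (0 : ℝ) 1) :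
        Tendsto (fun i => ∫ k, z ^ k ∂(P i).map (X i)) l (nhds (∫ k, z ^ k ∂ρ)) :=
      (h z hz).congr fun i => (integral_map (hX i) (by fun_prop)).symm
    have hsingleton (m : ℕ) : Tendsto (fun i => (P i).map (X i) {m}) l (nhds (ρ {m})) :=
      (ENNReal.tendsto_toReal_iff (fun _ => measure_ne_top _ _) (measure_ne_top _ _)).1
        (tendsto_measureReal_singleton_of_tendsto_integral_pow hpgf m)
    refine tendsto_of_forall_isOpen_le_liminf' fun G _ => ?_
    change ρ.map id G ≤ _
    rw [Measure.map_id]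
    exact measure_le_liminf_of_tendsto_singleton hsingleton G

end GeneratingFunction

end Ewens

theorem theorem6p2 (θ : ℝ) (hθ : 0 < θ)
    {Ω : ℕ → Type*} [∀ N, MeasurableSpace (Ω N)]
    (P : ∀ N, Measure (Ω N)) [∀ N, IsProbabilityMeasure (P N)]
    (σ : ∀ N, Ω N → Equiv.Perm (Fin N))
    (hσ : ∀ N, HasLaw (σ N) (Ewens.ewensMeasure θ N) (P N)) :
    TendstoInDistribution
      (fun (N : ℕ) (ω : Ω N) => (Ewens.numAdjacencies (σ N ω) : ℝ)) atTop
      (fun n : ℕ => (n : ℝ)) P (poissonMeasure 2) := by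
  have hmeas (N : ℕ) : AEMeasurable (fun ω => Ewens.numAdjacencies (σ N ω)) (P N) :=
    (Measurable.of_discrete (f := Ewens.numAdjacencies)).comp_aemeasurable (hσ N).aemeasurable
  have hpgf (z : ℝ) (hz : z ∈ Set.Icc (0 : ℝ) 1) :
      Tendsto (fun N => ∫ ω, z ^ Ewens.numAdjacencies (σ N ω) ∂P N) atTop
        (nhds (∫ k, z ^ k ∂poissonMeasure 2)) := by
    rw [Ewens.integral_pow_poissonMeasure]
    refine (Ewens.tendsto_integral_pow_numAdjacencies hθ hz).congr fun N => ?_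
    rw [← (hσ N).map_eq, integral_map (hσ N).aemeasurable (by fun_prop)]
  exact (Ewens.tendstoInDistribution_of_tendsto_integral_pow hmeas hpgf).continuous_comp
    (g := fun n : ℕ => (n : ℝ)) continuous_of_discreteTopology
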